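/- Let $n\ge 1$, $c>0$, and let a signed network on the nodes $V=\{0,\dots,n-1\}$ be given by a symmetric matrix $A$ with entries in $\{-1,0,1\}$ and $A_{ii}=1$; for $i\ne j$, $A_{ij}=1$ is an attractive edge, $A_{ij}=-1$ a repulsive edge, and $A_{ij}=0$ means no edge. Given initial opinions $x(0)\in\mathbb{R}^V$, the signed bounded-confidence dynamics with confidence bound $c$ is $$x_i(t+1)=x_i(t)+\frac{\sum_{j\in V}A_{ij}\,M_{ij}(t)\,\mathbf 1_{|x_j(t)-x_i(t)|<c}}{\sum_{j\in V}|A_{ij}|\,\mathbf 1_{|x_j(t)-x_i(t)|<c}},\qquad t=0,1,2,\dots,$$ where $$M_{ij}(t)=\begin{cases}x_j(t)-x_i(t) & \text{if } A_{ij}\ge 0,\\ \operatorname{sign}(x_j(t)-x_i(t))\,\bigl|c-|x_j(t)-x_i(t)|\bigr| & \text{if } A_{ij}=-1,\ x_j(t)\neq x_i(t),\\ \operatorname{sign}(j-i)\,c & \text{if } A_{ij}=-1,\ x_j(t)=x_i(t).\end{cases}$$ **Theorem.** Suppose that the network is the complete graph, that every edge is repulsive ($A_{ij}=-1$ for all $i\neq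 j$), and that $|x_i(0)-x_j(0)|<c$ for all $i,j\in V$. Then the dynamics converges: there is $y\in\mathbb{R}^V$ with $x(t)\to y$ as $t\to\infty$. The limit $y$ is a steady state (a fixed point of the update rule), it satisfies $$\max_{i,j\in V}|y_i-y_j|=(n-1)c,$$ and consecutive opinions in $y$ are exactly $c$ apart: the nodes can be ordered as $\sigma(0),\dots,\sigma(n-1)$ with $y_{\sigma(k+1)}-y_{\sigma(k)}=c$ for $0\le k<n-1$. -/

import Mathlib

open Filter Topology

/-- A signed network on the nodes `0, …, n - 1`, given by its symmetric adjacency matrix: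
`1` is an attractive edge, `-1` a repulsive edge, `0` no edge. Every node is attached to itself
with weight `1`, so that its own opinion enters the update. -/
structure SignedNetwork (n : ℕ) where
  adj : Fin n → Fin n → ℤ
  adj_mem : ∀ i j, adj i j = -1 ∨ adj i j = 0 ∨ adj i j = 1
  adj_symm : ∀ i j, adj i j = adj j i
  adj_self : ∀ i, adj i i = 1

namespace SignedNetwork

variable {n : ℕ}

/-- The underlying simple graph: distinct nodes joined by an attractive or a repulsive edge. -/
def graph (N : SignedNetwork n) : SimpleGraph (Fin n) where
  Adj i j := i ≠ j ∧ N.adj i j ≠ 0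
  symm := ⟨fun i j h => ⟨h.1.symm, by rw [N.adj_symm j i]; exact h.2⟩⟩
  loopless := ⟨fun _ h => h.1 rfl⟩

open Classical in
/-- The scaled signed displacement `M i j` for the confidence bound `c` and the opinions `x`. Two
repelling nodes with equal opinions are separated according to their indices. -/
noncomputable def displacement (N : SignedNetwork n) (c : ℝ) (x : Fin n → ℝ) (i j : Fin n) : ℝ :=
  if 0 ≤ N.adj i j then x j - x i
  else if x j = x i then Real.sign (((j : ℕ) : ℝ) - ((i : ℕ) : ℝ)) * c
  else Real.sign (x j - x i) * |(c - |x j - x i|)|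

open Classical in
/-- The indicator that the opinions of `i` and `j` are strictly within the confidence bound. -/
noncomputable def within (c : ℝ) (x : Fin n → ℝ) (i j : Fin n) : ℝ :=
  if |x j - x i| < c then 1 else 0

/-- One step of the signed bounded-confidence dynamics. -/
noncomputable def step (N : SignedNetwork n) (c : ℝ) (x : Fin n → ℝ) : Fin n → ℝ := fun i =>
  x i + (∑ j, (N.adj i j : ℝ) * N.displacement c x i j * within c x i j) /
    (∑ j, |(N.adj i j : ℝ)| * within c x i j)

/-- The opinion vector at time `t`, started from the initial opinions `x₀`. -/
noncomputable def opinions (N : SignedNetwork n) (c : ℝ) (x₀ : Fin n → ℝ) : ℕ → Fin n → ℝ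
  | 0 => x₀
  | t + 1 => N.step c (N.opinions c x₀ t)

end SignedNetwork

/-! Sort the opinions. Repulsion then moves rank `i` to the mean of `u j + c` over lower neighbours,
`u j - c` over upper ones, and `u i`; equivalently, its displacement times its number of neighbours
is the push from below minus the push from above.

Consecutive gaps never exceed `c`, even if nodes overtake one another
(`rankStep_succ_sub_castSucc_le`, `sorted_rankStep_gap_le`). The minimum decreases, and bounded gaps
bound the spread, so the minimum has a limit `ℓ`. By induction rank `i` tends to `ℓ + i * c`: once
ranks up to `i` converge, the push on `i` from below dies out, so a persistent push from above would
keep moving it (`tendsto_upperForce`); hence the next gap tends to `c`. The limits are distinct, so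
the order of the nodes finally freezes and convergence of ranks becomes convergence of opinions. -/

namespace SignedNetwork

variable {n m : ℕ}

/-! ### The sorted update and its forces -/

/-- The nodes whose opinions are within the confidence bound of the opinion of `i`. -/
noncomputable def neighbors (c : ℝ) (u : Fin n → ℝ) (i : Fin n) : Finset (Fin n) :=
  Finset.univ.filter fun j => |u j - u i| < c

/-- The position to which `j` pushes `i`, when the nodes are numbered by increasing opinions. -/
noncomputable def target (c : ℝ) (u : Fin n → ℝ) (i j : Fin n) : ℝ :=
  if j < i then u j + c else if i < j then u j - c else u j

/-- The fully repulsive update on opinions that are listed in increasing order: every node moves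
to the mean of its targets. -/
noncomputable def rankStep (c : ℝ) (u : Fin n → ℝ) (i : Fin n) : ℝ :=
  (∑ j ∈ neighbors c u i, target c u i j) / (neighbors c u i).card

/-- The total repulsion exerted on `i` by the nodes of smaller index. -/
noncomputable def lowerForce (c : ℝ) (u : Fin n → ℝ) (i : Fin n) : ℝ :=
  ∑ j, if j < i then max 0 (c - (u i - u j)) else 0

/-- The total repulsion exerted on `i` by the nodes of larger index. -/
noncomputable def upperForce (c : ℝ) (u : Fin n → ℝ) (i : Fin n) : ℝ :=
  ∑ j, if i < j then max 0 (c - (u j - u i)) else 0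

theorem mem_neighbors {c : ℝ} {u : Fin n → ℝ} {i j : Fin n} :
    j ∈ neighbors c u i ↔ |u j - u i| < c := by
  simp [neighbors]

theorem self_mem_neighbors {c : ℝ} (hc : 0 < c) (u : Fin n → ℝ) (i : Fin n) :
    i ∈ neighbors c u i := by
  simp [mem_neighbors, hc]

theorem card_neighbors_pos {c : ℝ} (hc : 0 < c) (u : Fin n → ℝ) (i : Fin n) :
    (0 : ℝ) < (neighbors c u i).card := by
  exact_mod_cast Finset.card_pos.mpr ⟨i, self_mem_neighbors hc u i⟩

theorem sum_target_sub_rankStep {c : ℝ} (hc : 0 < c) (u : Fin n → ℝ) (i : Fin n) :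
    ∑ j ∈ neighbors c u i, (target c u i j - rankStep c u i) = 0 := by
  have h := card_neighbors_pos hc u i
  rw [Finset.sum_sub_distrib, Finset.sum_const, nsmul_eq_mul, rankStep]
  field_simp
  ring

theorem card_mul_rankStep_sub {c : ℝ} (hc : 0 < c) {u : Fin n → ℝ} (hu : Monotone u)
    (i : Fin n) :
    (neighbors c u i).card * (rankStep c u i - u i) = lowerForce c u i - upperForce c u i := by
  have h := sum_target_sub_rankStep hc u i
  have h1 : ∑ j ∈ neighbors c u i, (target c u i j - rankStep c u i) =
      ∑ j ∈ neighbors c u i, (target c u i j - u i) -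
        (neighbors c u i).card * (rankStep c u i - u i) := by
    simp only [Finset.sum_sub_distrib, Finset.sum_const, nsmul_eq_mul]
    ring
  have h2 : ∑ j ∈ neighbors c u i, (target c u i j - u i) =
      lowerForce c u i - upperForce c u i := by
    rw [neighbors, Finset.sum_filter, lowerForce, upperForce, ← Finset.sum_sub_distrib]
    refine Finset.sum_congr rfl fun j _ => ?_
    rcases lt_trichotomy j i with hj | rfl | hj
    · have hle := hu hj.le
      rw [abs_sub_comm, abs_of_nonneg (sub_nonneg.mpr hle)]
      simp only [target, hj, hj.not_gt, if_true, if_false, sub_zero]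
      split_ifs with h3
      · rw [max_eq_right (by linarith)]; ring
      · rw [max_eq_left (by linarith)]
    · simp [target]
    · have hle := hu hj.le
      rw [abs_of_nonneg (sub_nonneg.mpr hle)]
      simp only [target, hj, hj.not_gt, if_true, if_false, zero_sub]
      split_ifs with h3
      · rw [max_eq_right (by linarith)]; ring
      · rw [max_eq_left (by linarith)]; ring
  linarith

theorem lowerForce_nonneg (c : ℝ) (u : Fin n → ℝ) (i : Fin n) : 0 ≤ lowerForce c u i :=
  Finset.sum_nonneg fun j _ => by split_ifs <;> simp

theorem upperForce_nonneg (c : ℝ) (u : Fin n → ℝ) (i : Fin n) : 0 ≤ upperForce c u i :=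
  Finset.sum_nonneg fun j _ => by split_ifs <;> simp

theorem one_le_card_neighbors {c : ℝ} (hc : 0 < c) (u : Fin n → ℝ) (i : Fin n) :
    (1 : ℝ) ≤ (neighbors c u i).card := by
  exact_mod_cast Finset.card_pos.mpr ⟨i, self_mem_neighbors hc u i⟩

theorem card_neighbors_le (c : ℝ) (u : Fin n → ℝ) (i : Fin n) :
    ((neighbors c u i).card : ℝ) ≤ n := by
  exact_mod_cast (Finset.card_le_univ _).trans_eq (Fintype.card_fin n)

theorem abs_rankStep_sub_le {c : ℝ} (hc : 0 < c) {u : Fin n → ℝ} (hu : Monotone u) (i : Fin n) :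
    |rankStep c u i - u i| ≤ lowerForce c u i + upperForce c u i := by
  have h := card_mul_rankStep_sub hc hu i
  have h1 := one_le_card_neighbors hc u i
  have h2 : |rankStep c u i - u i| ≤ |lowerForce c u i - upperForce c u i| := by
    rw [← h, abs_mul, abs_of_pos (card_neighbors_pos hc u i)]
    exact le_mul_of_one_le_left (abs_nonneg _) h1
  refine h2.trans (abs_le.mpr ⟨?_, ?_⟩) <;>
    linarith [lowerForce_nonneg c u i, upperForce_nonneg c u i]

/-- A node that ends no lower than `w` can only have been pushed down weakly. This follows from
`card_mul_rankStep_sub` and 1 ≤ card ≤ `n`. -/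
theorem upperForce_le_mul {c : ℝ} (hc : 0 < c) {u : Fin n → ℝ} (hu : Monotone u) {i : Fin n}
    {w : ℝ} (hw : w ≤ rankStep c u i) :
    upperForce c u i ≤ n * (u i - w + lowerForce c u i) := by
  have h := card_mul_rankStep_sub hc hu i
  have h1 := one_le_card_neighbors hc u i
  have h3 := lowerForce_nonneg c u i
  have h4 : upperForce c u i ≤
      (neighbors c u i).card * (u i - rankStep c u i + lowerForce c u i) := by nlinarith
  have h5 : 0 ≤ u i - rankStep c u i + lowerForce c u i :=
    nonneg_of_mul_nonneg_right ((upperForce_nonneg c u i).trans h4) (card_neighbors_pos hc u i)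
  calc upperForce c u i
      ≤ (neighbors c u i).card * (u i - rankStep c u i + lowerForce c u i) := h4
    _ ≤ n * (u i - rankStep c u i + lowerForce c u i) := by
        gcongr; exact_mod_cast card_neighbors_le c u i
    _ ≤ n * (u i - w + lowerForce c u i) := by gcongr

theorem le_rankStep_of_upperForce_eq_zero {c : ℝ} (hc : 0 < c) {u : Fin n → ℝ}
    (hu : Monotone u) {i : Fin n} (h : upperForce c u i = 0) : u i ≤ rankStep c u i := by
  have h1 := card_mul_rankStep_sub hc hu i
  rw [h, sub_zero] at h1
  have h2 : 0 ≤ rankStep c u i - u i :=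
    nonneg_of_mul_nonneg_right (h1 ▸ lowerForce_nonneg c u i) (card_neighbors_pos hc u i)
  linarith

theorem rankStep_le_of_lowerForce_eq_zero {c : ℝ} (hc : 0 < c) {u : Fin n → ℝ}
    (hu : Monotone u) {i : Fin n} (h : lowerForce c u i = 0) : rankStep c u i ≤ u i := by
  have h1 := card_mul_rankStep_sub hc hu i
  have h3 := upperForce_nonneg c u i
  by_contra! h4
  have := mul_pos (card_neighbors_pos hc u i) (sub_pos.mpr h4)
  linarith

theorem lowerForce_zero (c : ℝ) (u : Fin (m + 1) → ℝ) : lowerForce c u 0 = 0 := by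
  simp [lowerForce]

theorem upperForce_last (c : ℝ) (u : Fin (m + 1) → ℝ) : upperForce c u (Fin.last m) = 0 := by
  simp [upperForce, (Fin.le_last _).not_gt]

/-! ### Gaps stay at most `c` -/

theorem rankStep_succ_sub_castSucc_le {c : ℝ} (hc : 0 < c) {u : Fin (m + 1) → ℝ}
    (hu : Monotone u) {k : Fin m} (hk : u k.succ - u k.castSucc ≤ c) :
    rankStep c u k.succ - rankStep c u k.castSucc ≤ c := by
  set i := k.castSucc with hi
  set i' := k.succ with hi'
  have hlt : ∀ j, j < i' ↔ j ≤ i := fun j => by simp [hi, hi', Fin.lt_def, Fin.le_def]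
  have hgt : ∀ j, i < j ↔ i' ≤ j := fun j => by simp [hi, hi', Fin.lt_def, Fin.le_def]
  have hii : i < i' := (hlt i).2 le_rfl
  have hd := hu hii.le
  have hsum := sum_target_sub_rankStep hc u i
  have hsum' := sum_target_sub_rankStep hc u i'
  -- If `i` does not move down and the new gap exceeds `c`, every target of `i'` lies below the mean
  -- of these targets, which is absurd. The case where `i'` does not move up is symmetric.
  by_cases h1 : u i ≤ rankStep c u i
  · by_contra! hcon
    have : ∑ j ∈ neighbors c u i', (target c u i' j - rankStep c u i') < 0 := by
      refine Finset.sum_neg (fun j hj => ?_) ⟨i', self_mem_neighbors hc u i'⟩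
      rw [mem_neighbors, abs_lt] at hj
      unfold target
      split_ifs with h3 h4
      · have := hu ((hlt j).1 h3); linarith
      · linarith
      · rw [le_antisymm (not_lt.1 h4) (not_lt.1 h3)]; linarith
    linarith
  by_cases h2 : rankStep c u i' ≤ u i'
  · by_contra! hcon
    have : 0 < ∑ j ∈ neighbors c u i, (target c u i j - rankStep c u i) := by
      refine Finset.sum_pos (fun j hj => ?_) ⟨i, self_mem_neighbors hc u i⟩
      rw [mem_neighbors, abs_lt] at hj
      unfold target
      split_ifs with h3 h4
      · linarith
      · have := hu ((hgt j).1 h4); linarith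
      · rw [le_antisymm (not_lt.1 h4) (not_lt.1 h3)]; linarith
    linarith
  push Not at h1 h2
  -- Now `i` moves down and `i'` up. A neighbour of `i` alone lies at or below `i`, so its target
  -- exceeds the new position of `i`; dually for `i'`. On common neighbours the targets differ by at
  -- most `c`, so the means do too.
  have hextra : ∀ j ∈ neighbors c u i \ neighbors c u i',
      0 < target c u i j - rankStep c u i := by
    intro j hj
    rw [Finset.mem_sdiff, mem_neighbors, mem_neighbors, abs_lt, abs_lt] at hj
    obtain ⟨⟨h3, h4⟩, h5⟩ := hj
    unfold target
    split_ifs with h6 h7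
    · linarith
    · have := hu ((hgt j).1 h7)
      exact absurd ⟨by linarith, by linarith⟩ h5
    · rw [le_antisymm (not_lt.1 h7) (not_lt.1 h6)]; linarith
  have hextra' : ∀ j ∈ neighbors c u i' \ neighbors c u i,
      target c u i' j - rankStep c u i' < 0 := by
    intro j hj
    rw [Finset.mem_sdiff, mem_neighbors, mem_neighbors, abs_lt, abs_lt] at hj
    obtain ⟨⟨h3, h4⟩, h5⟩ := hj
    unfold target
    split_ifs with h6 h7
    · have := hu ((hlt j).1 h6)
      exact absurd ⟨by linarith, by linarith⟩ h5
    · linarith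
    · rw [le_antisymm (not_lt.1 h7) (not_lt.1 h6)]; linarith
  have hs := Finset.sum_inter_add_sum_sdiff (neighbors c u i) (neighbors c u i')
    (fun j => target c u i j - rankStep c u i)
  have hs' := Finset.sum_inter_add_sum_sdiff (neighbors c u i') (neighbors c u i)
    (fun j => target c u i' j - rankStep c u i')
  rw [Finset.inter_comm] at hs'
  have hpos := Finset.sum_nonneg fun j hj => (hextra j hj).le
  have hneg := Finset.sum_nonpos fun j hj => (hextra' j hj).le
  rcases (neighbors c u i ∩ neighbors c u i').eq_empty_or_nonempty with hE | hE
  · have hself : i ∈ neighbors c u i \ neighbors c u i' := by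
      rw [Finset.mem_sdiff]
      refine ⟨self_mem_neighbors hc u i, fun h => ?_⟩
      have := Finset.mem_inter.2 ⟨self_mem_neighbors hc u i, h⟩
      simp [hE] at this
    have := Finset.sum_pos hextra ⟨i, hself⟩
    rw [hE, Finset.sum_empty] at hs
    linarith
  · by_contra! hcon
    have hC : ∑ j ∈ neighbors c u i ∩ neighbors c u i', (target c u i' j - rankStep c u i') <
        ∑ j ∈ neighbors c u i ∩ neighbors c u i', (target c u i j - rankStep c u i) := by
      refine Finset.sum_lt_sum_of_nonempty hE fun j _ => ?_
      have : target c u i' j ≤ target c u i j + c := by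
        have h3 := hlt j
        unfold target
        split_ifs <;> first | linarith | grind
      linarith
    linarith

/-- If the consecutive gaps of `u` are at most `c`, then so are those of the sorted update. -/
theorem sorted_rankStep_gap_le {c : ℝ} (hc : 0 < c) {u v : Fin (m + 1) → ℝ} (hu : Monotone u)
    (hgap : ∀ k : Fin m, u k.succ - u k.castSucc ≤ c) (hv : Monotone v)
    (ρ : Equiv.Perm (Fin (m + 1))) (hρ : v = rankStep c u ∘ ρ) (k : Fin m) :
    v k.succ - v k.castSucc ≤ c := by
  by_contra! hcon
  -- A gap above `c` splits the updated values into low and high. The previous lemma makes lowness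
  -- pass from each index to the next, so the last node is low and node `0` high; but the extremes
  -- move outwards.
  have hsplit : ∀ i, rankStep c u i ≤ v k.castSucc ∨ v k.castSucc + c < rankStep c u i := by
    intro i
    have hi : rankStep c u i = v (ρ.symm i) := by simp [hρ]
    rw [hi]
    rcases le_or_gt (ρ.symm i) k.castSucc with h | h
    · exact Or.inl (hv h)
    · have := hv (Fin.castSucc_lt_iff_succ_le.1 h)
      exact Or.inr (by linarith)
  have hstep : ∀ l : Fin m, rankStep c u l.castSucc ≤ v k.castSucc →
      rankStep c u l.succ ≤ v k.castSucc := by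
    intro l hl
    have := rankStep_succ_sub_castSucc_le hc hu (hgap l)
    exact (hsplit l.succ).resolve_right (by linarith)
  have hup : ∀ i j : Fin (m + 1), i ≤ j → rankStep c u i ≤ v k.castSucc →
      rankStep c u j ≤ v k.castSucc := by
    intro i j
    induction j using Fin.induction with
    | zero => intro hij hi; rwa [← Fin.le_zero_iff.1 hij]
    | succ l ih =>
      intro hij hi
      rcases hij.eq_or_lt with rfl | hlt
      · exact hi
      · exact hstep l (ih (Fin.le_castSucc_iff.2 hlt) hi)
  have hlast := hup (ρ k.castSucc) (Fin.last m) (Fin.le_last _) (by simp [hρ])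
  have hzero : v k.castSucc + c < rankStep c u 0 := by
    refine (hsplit 0).resolve_left fun h => ?_
    have h1 := hup 0 (ρ k.succ) (Fin.zero_le _) h
    have h2 : rankStep c u (ρ k.succ) = v k.succ := by simp [hρ]
    linarith
  have h0 := rankStep_le_of_lowerForce_eq_zero hc hu (lowerForce_zero c u)
  have h1 := le_rankStep_of_upperForce_eq_zero hc hu (upperForce_last c u)
  have h2 := hu (Fin.zero_le (Fin.last m))
  linarith

/-- The `k`-th smallest of a family of values is at most one of the first `k + 1` of them. -/
theorem exists_le_of_monotone_comp_perm {v S : Fin n → ℝ} (hv : Monotone v)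
    (ρ : Equiv.Perm (Fin n)) (hρ : v = S ∘ ρ) (k : Fin n) : ∃ r ≤ k, v k ≤ S r := by
  by_contra! hcon
  -- Pigeonhole: otherwise `k + 1` indices inject into `k` positions.
  have hmap : ∀ r ∈ Finset.Iic k, ρ.symm r ∈ Finset.Iio k := by
    intro r hr
    have h := hcon r (Finset.mem_Iic.1 hr)
    rw [Finset.mem_Iio]
    by_contra! hle
    have h1 := hv hle
    simp only [hρ, Function.comp_apply, Equiv.apply_symm_apply] at h h1
    linarith
  have := Finset.card_le_card_of_injOn ρ.symm hmap ρ.symm.injective.injOn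
  simp at this

theorem sub_zero_le_of_gap_le {c : ℝ} {u : Fin (m + 1) → ℝ}
    (hgap : ∀ k : Fin m, u k.succ - u k.castSucc ≤ c) (k : Fin (m + 1)) :
    u k - u 0 ≤ k * c := by
  induction k using Fin.induction with
  | zero => simp
  | succ l ih =>
    have := hgap l
    simp only [Fin.val_castSucc, Fin.val_succ, Nat.cast_add, Nat.cast_one] at ih ⊢
    linarith

/-- The force from above is controlled by the gap to the next opinion. -/
theorem upperForce_castSucc_le {c : ℝ} {u : Fin (m + 1) → ℝ} (hu : Monotone u)
    (k : Fin m) (hk : u k.succ - u k.castSucc ≤ c) :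
    upperForce c u k.castSucc ≤ (m + 1 : ℕ) * (c - (u k.succ - u k.castSucc)) := by
  rw [← nsmul_eq_mul]
  refine (Finset.sum_le_card_nsmul _ _ (c - (u k.succ - u k.castSucc)) fun j _ => ?_).trans_eq
    (by simp)
  split_ifs with h
  · have := hu (Fin.castSucc_lt_iff_succ_le.1 h)
    exact max_le (by linarith) (by linarith)
  · linarith

/-- The nearest upper node alone contributes this much, so a vanishing upper force closes the
deficit of the gap from `c`. -/
theorem sub_sub_le_upperForce {c : ℝ} {u : Fin (m + 1) → ℝ} (k : Fin m) :
    c - (u k.succ - u k.castSucc) ≤ upperForce c u k.castSucc := by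
  have h := Finset.single_le_sum (s := Finset.univ)
    (f := fun j => if k.castSucc < j then max 0 (c - (u j - u k.castSucc)) else 0)
    (fun j _ => by split_ifs <;> simp) (Finset.mem_univ k.succ)
  refine le_trans ?_ h
  rw [if_pos Fin.castSucc_lt_succ]
  exact le_max_right _ _

theorem tendsto_lowerForce {c ℓ : ℝ} (hc : 0 < c) {u : ℕ → Fin n → ℝ} {i : Fin n}
    (h : ∀ r ≤ i, Tendsto (fun t => u t r) atTop (𝓝 (ℓ + r * c))) :
    Tendsto (fun t => lowerForce c (u t) i) atTop (𝓝 0) := by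
  rw [← Finset.sum_const_zero (s := (Finset.univ : Finset (Fin n)))]
  refine tendsto_finsetSum _ fun j _ => ?_
  split_ifs with hj
  · have h1 : Tendsto (fun t => max 0 (c - (u t i - u t j))) atTop
        (𝓝 (max 0 (c - ((ℓ + i * c) - (ℓ + j * c))))) :=
      tendsto_const_nhds.max (tendsto_const_nhds.sub ((h i le_rfl).sub (h j hj.le)))
    have h2 : (j : ℝ) + 1 ≤ i := by exact_mod_cast hj
    rwa [max_eq_left (by nlinarith)] at h1
  · exact tendsto_const_nhds

/-! ### Convergence of sorted orbits -/

/-- An orbit of the update on sorted opinions: the new opinions are sorted after every step. -/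
structure SortedOrbit (c : ℝ) (u : ℕ → Fin (m + 1) → ℝ) : Prop where
  monotone : ∀ t, Monotone (u t)
  gap_zero : ∀ k : Fin m, u 0 k.succ - u 0 k.castSucc ≤ c
  step : ∀ t, ∃ ρ : Equiv.Perm (Fin (m + 1)), u (t + 1) = rankStep c (u t) ∘ ρ

namespace SortedOrbit

variable {c : ℝ} {u : ℕ → Fin (m + 1) → ℝ}

theorem gap_le (h : SortedOrbit c u) (hc : 0 < c) (t : ℕ) (k : Fin m) :
    u t k.succ - u t k.castSucc ≤ c := by
  induction t generalizing k with
  | zero => exact h.gap_zero k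
  | succ t ih =>
    obtain ⟨ρ, hρ⟩ := h.step t
    exact sorted_rankStep_gap_le hc (h.monotone t) ih (h.monotone _) ρ hρ k

theorem exists_tendsto_zero (h : SortedOrbit c u) (hc : 0 < c) :
    ∃ ℓ, Tendsto (fun t => u t 0) atTop (𝓝 ℓ) := by
  have hanti : Antitone fun t => u t 0 := by
    refine antitone_nat_of_succ_le fun t => ?_
    obtain ⟨ρ, hρ⟩ := h.step t
    have h1 := h.monotone (t + 1) (Fin.zero_le (ρ.symm 0))
    have h2 : u (t + 1) (ρ.symm 0) = rankStep c (u t) 0 := by simp [hρ]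
    have h3 := rankStep_le_of_lowerForce_eq_zero hc (h.monotone t) (lowerForce_zero c (u t))
    linarith
  have hmono : Monotone fun t => u t (Fin.last m) := by
    refine monotone_nat_of_le_succ fun t => ?_
    obtain ⟨ρ, hρ⟩ := h.step t
    have h1 := h.monotone (t + 1) (Fin.le_last (ρ.symm (Fin.last m)))
    have h2 : u (t + 1) (ρ.symm (Fin.last m)) = rankStep c (u t) (Fin.last m) := by simp [hρ]
    have h3 := le_rankStep_of_upperForce_eq_zero hc (h.monotone t) (upperForce_last c (u t))
    linarith
  refine ⟨_, tendsto_atTop_ciInf hanti ⟨u 0 (Fin.last m) - m * c, ?_⟩⟩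
  rintro _ ⟨t, rfl⟩
  have h1 := sub_zero_le_of_gap_le (h.gap_le hc t) (Fin.last m)
  have h2 := hmono (Nat.zero_le t)
  simp only [Fin.val_last] at h1 h2 ⊢
  linarith

theorem tendsto_upperForce_of_succ (h : SortedOrbit c u) (hc : 0 < c) {ℓ : ℝ} {k : Fin m}
    (hk : ∀ r ≤ k.succ, Tendsto (fun t => u t r) atTop (𝓝 (ℓ + r * c))) :
    Tendsto (fun t => upperForce c (u t) k.castSucc) atTop (𝓝 0) := by
  refine squeeze_zero (fun t => upperForce_nonneg _ _ _)
    (fun t => upperForce_castSucc_le (h.monotone t) k (h.gap_le hc t k)) ?_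
  have h1 := ((hk _ le_rfl).sub (hk _ Fin.castSucc_lt_succ.le)).const_sub c
  have h2 := h1.const_mul ((m + 1 : ℕ) : ℝ)
  convert h2 using 2
  simp only [Fin.val_castSucc, Fin.val_succ, Nat.cast_add, Nat.cast_one]
  ring

theorem tendsto_rankStep_sub (h : SortedOrbit c u) (hc : 0 < c) {i : Fin (m + 1)}
    (hlow : Tendsto (fun t => lowerForce c (u t) i) atTop (𝓝 0))
    (hup : Tendsto (fun t => upperForce c (u t) i) atTop (𝓝 0)) :
    Tendsto (fun t => rankStep c (u t) i - u t i) atTop (𝓝 0) := by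
  refine squeeze_zero_norm (fun t => abs_rankStep_sub_le hc (h.monotone t) i) ?_
  simpa using hlow.add hup

theorem tendsto_rankStep (h : SortedOrbit c u) (hc : 0 < c) {ℓ : ℝ} {k : Fin m}
    (hk : ∀ r ≤ k.succ, Tendsto (fun t => u t r) atTop (𝓝 (ℓ + r * c))) :
    Tendsto (fun t => rankStep c (u t) k.castSucc) atTop (𝓝 (ℓ + (k : ℕ) * c)) := by
  have hlt : k.castSucc ≤ k.succ := Fin.castSucc_lt_succ.le
  have h1 := h.tendsto_rankStep_sub hc
    (tendsto_lowerForce hc fun r hr => hk r (hr.trans hlt)) (h.tendsto_upperForce_of_succ hc hk)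
  simpa using h1.add (hk _ hlt)

/-- If the lowest `k + 1` opinions converge to consecutive points at distance `c`, then the force
exerted from above on the last of them vanishes in the limit. -/
theorem tendsto_upperForce (h : SortedOrbit c u) (hc : 0 < c) {ℓ : ℝ} {i : Fin (m + 1)}
    (hi : ∀ r ≤ i, Tendsto (fun t => u t r) atTop (𝓝 (ℓ + r * c))) :
    Tendsto (fun t => upperForce c (u t) i) atTop (𝓝 0) := by
  have hshift : Tendsto (fun t => u (t + 1) i) atTop (𝓝 (ℓ + i * c)) :=
    (hi i le_rfl).comp (tendsto_add_atTop_nat 1)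
  -- Nodes below `i` feel vanishing forces, so their updates stay near limits smaller than that of
  -- rank `i`. The pigeonhole bound on the new rank `i` must then be realised by node `i` itself.
  have hbelow : ∀ r, r < i → ∀ᶠ t in atTop, rankStep c (u t) r < u (t + 1) i := by
    intro r hr
    obtain ⟨k, rfl⟩ := Fin.exists_castSucc_eq.2 (hr.trans_le (Fin.le_last i)).ne
    refine (h.tendsto_rankStep hc fun s hs =>
      hi s (hs.trans (Fin.castSucc_lt_iff_succ_le.1 hr))).eventually_lt hshift ?_
    have : ((k : ℕ) : ℝ) < (i : ℕ) := by exact_mod_cast hr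
    nlinarith
  have hev : ∀ᶠ t in atTop, u (t + 1) i ≤ rankStep c (u t) i := by
    filter_upwards [eventually_all.2 fun r => eventually_all.2 (hbelow r)] with t ht
    obtain ⟨ρ, hρ⟩ := h.step t
    obtain ⟨r, hr, hle⟩ := exists_le_of_monotone_comp_perm (h.monotone (t + 1)) ρ hρ i
    rcases hr.eq_or_lt with rfl | hlt
    · exact hle
    · exact absurd hle (ht r hlt).not_ge
  have hlim : Tendsto
      (fun t => (m + 1 : ℕ) * (u t i - u (t + 1) i + lowerForce c (u t) i)) atTop (𝓝 0) := by
    simpa using (((hi i le_rfl).sub hshift).add (tendsto_lowerForce hc hi)).const_mul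
      ((m + 1 : ℕ) : ℝ)
  refine squeeze_zero' (Eventually.of_forall fun t => upperForce_nonneg _ _ _) ?_ hlim
  filter_upwards [hev] with t ht
  exact upperForce_le_mul hc (h.monotone t) ht

theorem exists_tendsto (h : SortedOrbit c u) (hc : 0 < c) :
    ∃ ℓ, ∀ i, Tendsto (fun t => u t i) atTop (𝓝 (ℓ + i * c)) := by
  obtain ⟨ℓ, hℓ⟩ := h.exists_tendsto_zero hc
  refine ⟨ℓ, fun i => ?_⟩
  suffices H : ∀ r ≤ i, Tendsto (fun t => u t r) atTop (𝓝 (ℓ + r * c)) from H i le_rfl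
  induction i using Fin.induction with
  | zero =>
    intro r hr
    rw [Fin.le_zero_iff.1 hr]
    simpa using hℓ
  | succ k ih =>
    intro r hr
    rcases hr.eq_or_lt with rfl | hlt
    · have h1 : Tendsto (fun t => u t k.succ - u t k.castSucc) atTop (𝓝 c) := by
        refine tendsto_of_tendsto_of_tendsto_of_le_of_le
          (g := fun t => c - upperForce c (u t) k.castSucc) ?_ tendsto_const_nhds
          (fun t => ?_) (fun t => h.gap_le hc t k)
        · simpa using (h.tendsto_upperForce hc ih).const_sub c
        · have := sub_sub_le_upperForce (c := c) (u := u t) k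
          simp only
          linarith
      have h2 := h1.add (ih _ le_rfl)
      simp only [sub_add_cancel] at h2
      convert h2 using 2
      simp only [Fin.val_castSucc, Fin.val_succ, Nat.cast_add, Nat.cast_one]
      ring
    · exact ih r (Fin.le_castSucc_iff.2 hlt)

theorem eventually_strictMono_rankStep (h : SortedOrbit c u) (hc : 0 < c) :
    ∀ᶠ t in atTop, StrictMono (rankStep c (u t)) := by
  obtain ⟨ℓ, hℓ⟩ := h.exists_tendsto hc
  have hlim : ∀ i, Tendsto (fun t => rankStep c (u t) i) atTop (𝓝 (ℓ + i * c)) := fun i => by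
    simpa using (h.tendsto_rankStep_sub (i := i) hc (tendsto_lowerForce hc fun r _ => hℓ r)
      (h.tendsto_upperForce hc fun r _ => hℓ r)).add (hℓ i)
  have hev : ∀ k : Fin m, ∀ᶠ t in atTop,
      rankStep c (u t) k.castSucc < rankStep c (u t) k.succ := fun k => by
    refine (hlim _).eventually_lt (hlim _) ?_
    simp only [Fin.val_castSucc, Fin.val_succ, Nat.cast_add, Nat.cast_one]
    linarith
  filter_upwards [eventually_all.2 hev] with t ht
  exact Fin.strictMono_iff_lt_succ.2 ht

end SortedOrbit

/-! ### From ranks back to nodes -/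

/-- `Tuple.sort` breaks ties by index, exactly as the displacement of equal opinions does. -/
theorem sort_lt_sort_of_apply_eq {x : Fin n → ℝ} {i j : Fin n} (hij : i < j)
    (h : x (Tuple.sort x i) = x (Tuple.sort x j)) : Tuple.sort x i < Tuple.sort x j :=
  (Tuple.eq_sort_iff.1 rfl).2 i j hij h

theorem adj_mul_displacement_sort (N : SignedNetwork n) (hN : ∀ i j, i ≠ j → N.adj i j = -1)
    {c : ℝ} (x : Fin n → ℝ) {k j : Fin n} (hj : j ∈ neighbors c (x ∘ Tuple.sort x) k) :
    (N.adj (Tuple.sort x k) (Tuple.sort x j) : ℝ) *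
      N.displacement c x (Tuple.sort x k) (Tuple.sort x j) =
    target c (x ∘ Tuple.sort x) k j - x (Tuple.sort x k) := by
  have hmono := Tuple.monotone_sort x
  rw [mem_neighbors] at hj
  simp only [Function.comp_apply] at hj
  rcases lt_trichotomy j k with h | rfl | h
  · have hadj := hN _ _ ((Tuple.sort x).injective.ne h.ne')
    have hle : x (Tuple.sort x j) ≤ x (Tuple.sort x k) := hmono h.le
    simp only [displacement, hadj, target, h, Function.comp_apply, if_true]
    rw [if_neg (by norm_num)]
    split_ifs with heq
    · have hlt : ((Tuple.sort x j : ℕ) : ℝ) < (Tuple.sort x k : ℕ) := by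
        exact_mod_cast sort_lt_sort_of_apply_eq h heq
      rw [Real.sign_of_neg (sub_neg.2 hlt), heq]
      push_cast
      ring
    · have hlt := lt_of_le_of_ne hle heq
      rw [Real.sign_of_neg (sub_neg.2 hlt), abs_of_nonneg (sub_nonneg.2 hj.le),
        abs_of_neg (sub_neg.2 hlt)]
      push_cast
      ring
  · simp [displacement, N.adj_self, target]
  · have hadj := hN _ _ ((Tuple.sort x).injective.ne h.ne)
    have hle : x (Tuple.sort x k) ≤ x (Tuple.sort x j) := hmono h.le
    simp only [displacement, hadj, target, h, h.not_gt, Function.comp_apply, if_true, if_false]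
    rw [if_neg (by norm_num)]
    split_ifs with heq
    · have hlt : ((Tuple.sort x k : ℕ) : ℝ) < (Tuple.sort x j : ℕ) := by
        exact_mod_cast sort_lt_sort_of_apply_eq h heq.symm
      rw [Real.sign_of_pos (sub_pos.2 hlt), heq]
      push_cast
      ring
    · have hlt := lt_of_le_of_ne hle (Ne.symm heq)
      rw [Real.sign_of_pos (sub_pos.2 hlt), abs_of_nonneg (sub_nonneg.2 hj.le),
        abs_of_pos (sub_pos.2 hlt)]
      push_cast
      ring

/-- The complete network all of whose edges are repulsive acts on the sorted opinions by
`rankStep`. -/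
theorem step_comp_sort (N : SignedNetwork n) (hN : ∀ i j, i ≠ j → N.adj i j = -1) {c : ℝ}
    (hc : 0 < c) (x : Fin n → ℝ) :
    N.step c x ∘ Tuple.sort x = rankStep c (x ∘ Tuple.sort x) := by
  funext k
  have habs : ∀ i j, |(N.adj i j : ℝ)| = 1 := fun i j => by
    rcases eq_or_ne i j with rfl | hij
    · simp [N.adj_self]
    · simp [hN i j hij]
  have hnum : ∑ j, (N.adj (Tuple.sort x k) j : ℝ) * N.displacement c x (Tuple.sort x k) j *
      within c x (Tuple.sort x k) j =
      ∑ j ∈ neighbors c (x ∘ Tuple.sort x) k,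
        (target c (x ∘ Tuple.sort x) k j - x (Tuple.sort x k)) := by
    rw [← Equiv.sum_comp (Tuple.sort x), neighbors, Finset.sum_filter]
    refine Finset.sum_congr rfl fun j _ => ?_
    split_ifs with hj
    · rw [adj_mul_displacement_sort N hN x (mem_neighbors.2 hj), within,
        if_pos (by simpa using hj), mul_one]
    · rw [within, if_neg (by simpa using hj), mul_zero]
  have hden : ∑ j, |(N.adj (Tuple.sort x k) j : ℝ)| * within c x (Tuple.sort x k) j =
      (neighbors c (x ∘ Tuple.sort x) k).card := by
    rw [← Equiv.sum_comp (Tuple.sort x), neighbors, Finset.natCast_card_filter]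
    simp [habs, within]
  have hpos := card_neighbors_pos hc (x ∘ Tuple.sort x) k
  rw [Function.comp_apply, step, hnum, hden, rankStep, Finset.sum_sub_distrib, Finset.sum_const,
    nsmul_eq_mul]
  field_simp
  ring

/-- The confidence bound is strict, so nodes exactly `c` apart do not interact. -/
theorem step_eq_self (N : SignedNetwork n) {c : ℝ} {y : Fin n → ℝ}
    (hy : ∀ i j, i ≠ j → c ≤ |y j - y i|) : N.step c y = y := by
  funext i
  have h : ∀ j, (N.adj i j : ℝ) * N.displacement c y i j * within c y i j = 0 := by
    intro j
    rcases eq_or_ne i j with rfl | hij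
    · simp [displacement, N.adj_self]
    · simp [within, (hy i j hij).not_gt]
  simp [step, h]

theorem sortedOrbit_opinions (N : SignedNetwork (m + 1))
    (hN : ∀ i j, i ≠ j → N.adj i j = -1) {c : ℝ} (hc : 0 < c) {x₀ : Fin (m + 1) → ℝ}
    (hx₀ : ∀ i j, |x₀ i - x₀ j| < c) :
    SortedOrbit c fun t => N.opinions c x₀ t ∘ Tuple.sort (N.opinions c x₀ t) where
  monotone t := Tuple.monotone_sort _
  gap_zero k := (le_abs_self _).trans (hx₀ _ _).le
  step t := by
    refine ⟨(Tuple.sort (N.opinions c x₀ (t + 1))).trans (Tuple.sort (N.opinions c x₀ t)).symm, ?_⟩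
    rw [← step_comp_sort N hN hc]
    funext i
    simp [opinions]

/-- The opinions of a complete repulsive network converge, after a fixed renumbering, to points
at consecutive distances `c`. -/
theorem exists_tendsto_opinions (N : SignedNetwork (m + 1))
    (hN : ∀ i j, i ≠ j → N.adj i j = -1) {c : ℝ} (hc : 0 < c) {x₀ : Fin (m + 1) → ℝ}
    (hx₀ : ∀ i j, |x₀ i - x₀ j| < c) :
    ∃ (ℓ : ℝ) (σ : Equiv.Perm (Fin (m + 1))),
      Tendsto (N.opinions c x₀) atTop (𝓝 fun i => ℓ + ((σ.symm i : ℕ) : ℝ) * c) := by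
  have h := sortedOrbit_opinions N hN hc hx₀
  obtain ⟨ℓ, hℓ⟩ := h.exists_tendsto hc
  obtain ⟨T, hT⟩ := eventually_atTop.1 (h.eventually_strictMono_rankStep hc)
  -- After time `T` the update is strictly increasing in the current order, so that order also sorts
  -- the next opinions.
  have hsort : ∀ t ≥ T, Tuple.sort (N.opinions c x₀ t) = Tuple.sort (N.opinions c x₀ T) := by
    intro t ht
    induction t, ht using Nat.le_induction with
    | base => rfl
    | succ t ht ih =>
      rw [← ih]
      symm
      have hmono : StrictMono (N.opinions c x₀ (t + 1) ∘ Tuple.sort (N.opinions c x₀ t)) := by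
        have h1 := hT t ht
        rwa [← step_comp_sort N hN hc] at h1
      exact Tuple.eq_sort_iff.2
        ⟨hmono.monotone, fun i j hij heq => absurd (hmono.injective heq) hij.ne⟩
  refine ⟨ℓ, Tuple.sort (N.opinions c x₀ T), tendsto_pi_nhds.2 fun i => ?_⟩
  refine (hℓ ((Tuple.sort (N.opinions c x₀ T)).symm i)).congr' ?_
  filter_upwards [eventually_ge_atTop T] with t ht
  simp [hsort t ht]

end SignedNetwork

theorem mainTheorem1 {n : ℕ} (hn : 1 ≤ n) (c : ℝ) (hc : 0 < c) (N : SignedNetwork n)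
    (hcomplete : N.graph = ⊤)
    (hrepulsive : ∀ i j, N.graph.Adj i j → N.adj i j = -1)
    (x₀ : Fin n → ℝ) (hx₀ : ∀ i j, |x₀ i - x₀ j| < c) :
    ∃ y : Fin n → ℝ,
      Tendsto (N.opinions c x₀) atTop (𝓝 y) ∧
      N.step c y = y ∧
      IsGreatest (Set.range fun p : Fin n × Fin n => |y p.1 - y p.2|) (((n : ℝ) - 1) * c) ∧
      ∃ σ : Equiv.Perm (Fin n), ∀ (k : ℕ) (hk : k + 1 < n),
        y (σ ⟨k + 1, hk⟩) - y (σ ⟨k, Nat.lt_of_succ_lt hk⟩) = c := by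
  obtain ⟨m, rfl⟩ := Nat.exists_eq_add_of_le' hn
  have hN : ∀ i j, i ≠ j → N.adj i j = -1 := fun i j hij =>
    hrepulsive i j (by rw [hcomplete]; exact hij)
  obtain ⟨ℓ, σ, hlim⟩ := N.exists_tendsto_opinions hN hc hx₀
  have hdist : ∀ i j : Fin (m + 1), |(ℓ + ((σ.symm i : ℕ) : ℝ) * c) -
      (ℓ + ((σ.symm j : ℕ) : ℝ) * c)| = |((σ.symm i : ℕ) : ℝ) - (σ.symm j : ℕ)| * c := by
    intro i j
    rw [add_sub_add_left_eq_sub, ← sub_mul, abs_mul, abs_of_pos hc]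
  refine ⟨_, hlim, N.step_eq_self fun i j hij => ?_, ⟨⟨(σ (Fin.last m), σ 0), ?_⟩, ?_⟩, σ, ?_⟩
  · rw [hdist]
    refine le_mul_of_one_le_left hc.le ?_
    have h1 : ((σ.symm j : ℕ) : ℤ) - (σ.symm i : ℕ) ≠ 0 := fun h =>
      hij (σ.symm.injective (Fin.ext (by omega)))
    exact_mod_cast Int.one_le_abs h1
  · simp only [hdist]
    simp
  · rintro _ ⟨⟨i, j⟩, rfl⟩
    simp only [hdist]
    gcongr
    have hi : ((σ.symm i : ℕ) : ℝ) ≤ m := by exact_mod_cast Nat.lt_succ_iff.1 (σ.symm i).2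
    have hj : ((σ.symm j : ℕ) : ℝ) ≤ m := by exact_mod_cast Nat.lt_succ_iff.1 (σ.symm j).2
    have hi0 : (0 : ℝ) ≤ (σ.symm i : ℕ) := Nat.cast_nonneg _
    have hj0 : (0 : ℝ) ≤ (σ.symm j : ℕ) := Nat.cast_nonneg _
    push_cast
    exact abs_le.2 ⟨by linarith, by linarith⟩
  · intro k hk
    simp only [Equiv.symm_apply_apply]
    push_cast
    ring
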